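/- Let $n\in\mathbb N$ and let $J\subseteq\mathbb R$ be an interval of positive length with $0\in J$ (for instance $J=\mathbb R$, $J=[0,\infty)$ or $J=[0,T]$). Let $u=u(t,x)$ be a real-valued solution of the homogeneous wave equation $$\Delta u-\frac{\partial^2u}{\partial t^2}=0,\qquad \Delta=\sum_{i=1}^n\frac{\partial^2}{\partial x_i^2},$$ on $J\times\mathbb R^n$; that is, $u$ is continuously differentiable on $J\times\mathbb R^n$ (up to those end points of $J$ that belong to $J$), and at every point $(t,x)$ with $t$ in the interior of $J$ it is twice (Fréchet) differentiable and satisfies the equation. If the initial values $u|_{t=0}$ and $\frac{\partial u}{\partial t}\big|_{t=0}$ are infinitely differentiable on the whole space $\mathbb R^n$ (the time derivative being one-sided if $0$ is an end point of $J$), then $u$ is infinitely differentiable, jointly in $(t,x)$, on $J\times\mathbb R^n$ (up to those end points of $J$ that belong to $J$). -/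

import Mathlib

open scoped ContDiff

/-- A classical solution `u = u(t, x)` of the homogeneous wave equation `Δ u - ∂²u/∂t² = 0`
on `J × ℝⁿ`, where `J` is an interval of times: `u` is continuously differentiable on `J × ℝⁿ`
(up to the end points of `J` that belong to `J`), it is twice differentiable at all points
whose time is interior to `J`, and it satisfies the equation at these points. -/
structure IsWaveSolution {n : ℕ} (J : Set ℝ) (u : ℝ × EuclideanSpace ℝ (Fin n) → ℝ) : Prop where
  contDiffOn_one : ContDiffOn ℝ 1 u (J ×ˢ Set.univ)
  differentiableAt_fderiv : ∀ t ∈ interior J, ∀ x : EuclideanSpace ℝ (Fin n),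
    DifferentiableAt ℝ (fderiv ℝ u) (t, x)
  equation : ∀ t ∈ interior J, ∀ x : EuclideanSpace ℝ (Fin n),
    Laplacian.laplacian (fun y => u (t, y)) x
      - iteratedDeriv 2 (fun s => u (s, x)) t = 0

/-- The initial value `u|_{t=0}`. -/
def initialValue {n : ℕ} (u : ℝ × EuclideanSpace ℝ (Fin n) → ℝ) :
    EuclideanSpace ℝ (Fin n) → ℝ :=
  fun x => u (0, x)

/-- The initial velocity `(∂u/∂t)|_{t=0}`; the derivative is one-sided if `0` is an end point of
the interval `J` of times. -/
noncomputable def initialVelocity {n : ℕ} (J : Set ℝ) (u : ℝ × EuclideanSpace ℝ (Fin n) → ℝ) :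
    EuclideanSpace ℝ (Fin n) → ℝ :=
  fun x => derivWithin (fun s => u (s, x)) J 0

/-! Smoothness is a local property, and waves travel with speed at most one, so `u` near a point is
determined by its initial data on a ball. Multiplying the data by a bump function equal to 1 on that
ball gives compactly supported smooth data, which generate a smooth global solution `w`
(`exists_wave`). Finite propagation speed then forces `u = w` in a cone around the point
(`IsWaveSolution.eq_of_initial_eq`), and `u` inherits the smoothness of `w`.

Existence uses the half-wave `∫ exp(2πi(t|ξ| + x·ξ)) f̂(ξ) dξ`, smooth because `f̂` decays rapidly.
The even part in time of its real part has data `(f, 0)`; the time primitive of a solution with data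
`(g, 0)` has data `(0, g)`.

Uniqueness is an energy argument for the gradient of `u - w` (`eq_zero_of_wave_gradient`). Energy
density and flux are weighted by a cutoff vanishing outside the backward cone, so the divergence
theorem can be used on a box. Only continuity of the gradient up to `t = 0` and pointwise existence
of second derivatives at interior times are needed. -/

open MeasureTheory
open scoped FourierTransform RealInnerProductSpace SchwartzMap

/-! ### Energy estimate in a backward light cone -/

/-- A smooth cutoff supported in the backward light cone `|x| ≤ R - t`. -/
noncomputable def coneCutoff {n : ℕ} (R : ℝ) (y : Fin (n + 1) → ℝ) : ℝ :=
  expNegInvGlue ((R - y 0) ^ 2 - ∑ i : Fin n, y i.succ ^ 2)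

/-- The function is nonnegative, so each of its zeros is a minimum. Thanks to this, the sign of the
energy loss has to be checked only inside the cone. -/
theorem deriv_expNegInvGlue_of_nonpos {s : ℝ} (hs : s ≤ 0) : deriv expNegInvGlue s = 0 :=
  IsLocalMin.deriv_eq_zero <| Filter.Eventually.of_forall fun r => by
    simpa [expNegInvGlue.zero_of_nonpos hs] using expNegInvGlue.nonneg r

theorem hasFDerivAt_coneCutoff {n : ℕ} (R : ℝ) (y : Fin (n + 1) → ℝ) :
    HasFDerivAt (coneCutoff R)
      (deriv expNegInvGlue ((R - y 0) ^ 2 - ∑ i : Fin n, y i.succ ^ 2) •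
        ((-2 * (R - y 0)) • (ContinuousLinearMap.proj 0 : (Fin (n + 1) → ℝ) →L[ℝ] ℝ)
          - ∑ i : Fin n, (2 * y i.succ) • ContinuousLinearMap.proj i.succ)) y := by
  have hp (j : Fin (n + 1)) : HasFDerivAt (fun y : Fin (n + 1) → ℝ => y j)
      (ContinuousLinearMap.proj j : (Fin (n + 1) → ℝ) →L[ℝ] ℝ) y := hasFDerivAt_apply j y
  have hφ : HasDerivAt expNegInvGlue
      (deriv expNegInvGlue ((R - y 0) ^ 2 - ∑ i : Fin n, y i.succ ^ 2))
      ((R - y 0) ^ 2 - ∑ i : Fin n, y i.succ ^ 2) :=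
    ((expNegInvGlue.contDiff (n := 1)).differentiable (by simp) _).hasDerivAt
  have hs : HasFDerivAt (fun y : Fin (n + 1) → ℝ => (R - y 0) ^ 2 - ∑ i : Fin n, y i.succ ^ 2)
      ((-2 * (R - y 0)) • (ContinuousLinearMap.proj 0 : (Fin (n + 1) → ℝ) →L[ℝ] ℝ)
          - ∑ i : Fin n, (2 * y i.succ) • ContinuousLinearMap.proj i.succ) y := by
    refine HasFDerivAt.sub ?_ (HasFDerivAt.fun_sum fun i _ => ?_)
    · exact (((hp 0).const_sub R).pow 2).congr_fderiv (by ext v; simp)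
    · exact ((hp i.succ).pow 2).congr_fderiv (by ext v; simp)
  exact hφ.comp_hasFDerivAt y hs

theorem continuous_coneCutoff {n : ℕ} (R : ℝ) :
    Continuous (coneCutoff R : (Fin (n + 1) → ℝ) → ℝ) :=
  (expNegInvGlue.contDiff (n := 0)).continuous.comp (by fun_prop)

/-- The pointwise inequality `x · (p q) ≤ ρ (p² + |q|²) / 2` for `|x| ≤ ρ`. -/
theorem two_mul_sum_mul_mul_le {n : ℕ} {x q : Fin n → ℝ} {p r : ℝ} (hr : 0 ≤ r)
    (hx : ∑ i, x i ^ 2 ≤ r ^ 2) :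
    2 * ∑ i, x i * (p * q i) ≤ r * (p ^ 2 + ∑ i, q i ^ 2) := by
  have h1 := Finset.sum_mul_sq_le_sq_mul_sq Finset.univ x q
  have hq : 0 ≤ ∑ i, q i ^ 2 := Finset.sum_nonneg fun i _ => sq_nonneg _
  set Q := √(∑ i, q i ^ 2)
  have hQ : Q ^ 2 = ∑ i, q i ^ 2 := Real.sq_sqrt hq
  have hQ0 : 0 ≤ Q := Real.sqrt_nonneg _
  have h2 : |∑ i, x i * q i| ≤ r * Q := by
    apply abs_le_of_sq_le_sq _ (by positivity)
    rw [mul_pow, hQ]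
    exact h1.trans (by gcongr)
  have h3 : ∑ i, x i * (p * q i) = p * ∑ i, x i * q i := by
    rw [Finset.mul_sum]
    exact Finset.sum_congr rfl fun i _ => by ring
  have h4 : p * ∑ i, x i * q i ≤ |p| * (r * Q) := by
    refine (le_abs_self _).trans ?_
    rw [abs_mul]
    gcongr
  rw [h3, ← hQ, ← sq_abs p]
  nlinarith [mul_nonneg hr (sq_nonneg (|p| - Q))]

/-- Energy estimate in the backward light cone for a gradient field `g` satisfying the wave
equation: if `g` vanishes on the base of the cone, it vanishes on its sections. -/
theorem eq_zero_of_wave_gradient {n : ℕ} {T R : ℝ} (hT : 0 < T) (hTR : T < R)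
    {g : Fin (n + 1) → (Fin (n + 1) → ℝ) → ℝ}
    {g' : Fin (n + 1) → (Fin (n + 1) → ℝ) → (Fin (n + 1) → ℝ) →L[ℝ] ℝ}
    (hc : ∀ j, ContinuousOn (g j) {y | 0 ≤ y 0 ∧ y 0 ≤ T})
    (hd : ∀ j y, 0 < y 0 → y 0 < T → HasFDerivAt (g j) (g' j y) y)
    (hsymm : ∀ y, 0 < y 0 → y 0 < T → ∀ i j, g' i y (Pi.single j 1) = g' j y (Pi.single i 1))
    (heq : ∀ y, 0 < y 0 → y 0 < T →
      g' 0 y (Pi.single 0 1) = ∑ i : Fin n, g' i.succ y (Pi.single i.succ 1))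
    (hinit : ∀ y, y 0 = 0 → ∑ i : Fin n, y i.succ ^ 2 < R ^ 2 → ∀ j, g j y = 0)
    {y : Fin (n + 1) → ℝ} (hy0 : y 0 = T) (hy : ∑ i : Fin n, y i.succ ^ 2 < (R - T) ^ 2)
    (j : Fin (n + 1)) : g j y = 0 := by
  have hR : 0 < R := hT.trans hTR
  set a : Fin (n + 1) → ℝ := Fin.cons 0 fun _ => -R
  set b : Fin (n + 1) → ℝ := Fin.cons T fun _ => R
  have hab : a ≤ b := by
    intro i
    refine Fin.cases ?_ (fun i => ?_) i
    · simpa [a, b] using hT.le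
    · simp [a, b]; linarith
  set θ : (Fin (n + 1) → ℝ) → ℝ := coneCutoff R
  set s : (Fin (n + 1) → ℝ) → ℝ := fun y => (R - y 0) ^ 2 - ∑ i : Fin n, y i.succ ^ 2
  set e : (Fin (n + 1) → ℝ) → ℝ := fun y => (g 0 y ^ 2 + ∑ i : Fin n, g i.succ y ^ 2) / 2
  -- Energy density in the time slot, energy flux in the space slots, both weighted by the cutoff.
  set F : Fin (n + 1) → (Fin (n + 1) → ℝ) → ℝ :=
    Fin.cons (fun y => θ y * e y) fun i y => -(θ y * (g 0 y * g i.succ y))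
  set θ' : (Fin (n + 1) → ℝ) → (Fin (n + 1) → ℝ) →L[ℝ] ℝ := fun y =>
    deriv expNegInvGlue (s y) •
        ((-2 * (R - y 0)) • (ContinuousLinearMap.proj 0 : (Fin (n + 1) → ℝ) →L[ℝ] ℝ)
          - ∑ i : Fin n, (2 * y i.succ) • ContinuousLinearMap.proj i.succ)
  have hθd (y) : HasFDerivAt θ (θ' y) y := hasFDerivAt_coneCutoff R y
  have hθc : Continuous θ := continuous_coneCutoff R
  set e' : (Fin (n + 1) → ℝ) → (Fin (n + 1) → ℝ) →L[ℝ] ℝ := fun y =>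
    g 0 y • g' 0 y + ∑ i : Fin n, g i.succ y • g' i.succ y
  set F' : Fin (n + 1) → (Fin (n + 1) → ℝ) → (Fin (n + 1) → ℝ) →L[ℝ] ℝ :=
    Fin.cons (fun y => θ y • e' y + e y • θ' y) fun i y =>
      -(θ y • (g 0 y • g' i.succ y + g i.succ y • g' 0 y) + (g 0 y * g i.succ y) • θ' y)
  have hsub : Set.Icc a b ⊆ {y | 0 ≤ y 0 ∧ y 0 ≤ T} := fun y hy =>
    ⟨by simpa [a] using hy.1 0, by simpa [b] using hy.2 0⟩
  have hgc (j) : ContinuousOn (g j) (Set.Icc a b) := (hc j).mono hsub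
  have hec : ContinuousOn e {y | 0 ≤ y 0 ∧ y 0 ≤ T} :=
    (((hc 0).pow 2).add (continuousOn_finsetSum _ fun i _ => (hc i.succ).pow 2)).div_const 2
  have hFc (i) : ContinuousOn (F i) (Set.Icc a b) := by
    refine Fin.cases ?_ (fun i => ?_) i
    · exact hθc.continuousOn.mul (hec.mono hsub)
    · exact (hθc.continuousOn.mul ((hgc 0).mul (hgc i.succ))).neg
  have hint {y} (hy : y ∈ Set.univ.pi fun i => Set.Ioo (a i) (b i)) : 0 < y 0 ∧ y 0 < T := by
    simpa [a, b] using hy 0 trivial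
  have hed (y) (h1 : 0 < y 0) (h2 : y 0 < T) : HasFDerivAt e (e' y) y := by
    have h3 : HasFDerivAt (fun y => (g 0 y ^ 2 + ∑ i : Fin n, g i.succ y ^ 2))
      ((2 * g 0 y ^ 1) • g' 0 y + ∑ i : Fin n, (2 * g i.succ y ^ 1) • g' i.succ y) y :=
      HasFDerivAt.add (by simpa using (hd 0 y h1 h2).pow 2)
        (HasFDerivAt.fun_sum fun i _ => by simpa using (hd i.succ y h1 h2).pow 2)
    have h4 : e = fun y => 1 / 2 * (g 0 y ^ 2 + ∑ i : Fin n, g i.succ y ^ 2) := by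
      ext z; simp only [e]; ring
    rw [h4]
    refine (h3.const_mul (1 / 2)).congr_fderiv ?_
    simp only [e', smul_add, Finset.smul_sum, smul_smul]
    congr 1
    · congr 1; ring
    · exact Finset.sum_congr rfl fun i _ => by congr 1; ring
  have hFd (y) (hy : y ∈ Set.univ.pi fun i => Set.Ioo (a i) (b i)) (i) :
      HasFDerivAt (F i) (F' i y) y := by
    obtain ⟨h1, h2⟩ := hint hy
    refine Fin.cases ?_ (fun i => ?_) i
    · exact (hθd y).mul (hed y h1 h2)
    · exact ((hθd y).mul ((hd 0 y h1 h2).mul (hd i.succ y h1 h2))).neg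
  -- By the equation and the symmetry of `g'`, the terms in which the energy and flux are
  -- differentiated cancel; what remains is the derivative of the cutoff.
  set D : (Fin (n + 1) → ℝ) → ℝ := fun y =>
    -(deriv expNegInvGlue (s y) * (2 * (R - y 0) * e y - 2 * ∑ i : Fin n, y i.succ *
      (g 0 y * g i.succ y)))
  have hθ0 (y) : θ' y (Pi.single 0 1) = -(deriv expNegInvGlue (s y) * (2 * (R - y 0))) := by
    simp [θ']
  have hθi (y) (i : Fin n) :
      θ' y (Pi.single i.succ 1) = -(deriv expNegInvGlue (s y) * (2 * y i.succ)) := by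
    simp [θ', Pi.single_apply]
  have hdiv (y) (hy : y ∈ Set.univ.pi fun i => Set.Ioo (a i) (b i)) :
      ∑ i, F' i y (Pi.single i 1) = D y := by
    obtain ⟨h1, h2⟩ := hint hy
    rw [Fin.sum_univ_succ]
    simp only [F', Fin.cons_zero, Fin.cons_succ, e', add_apply,
      neg_apply, smul_apply, smul_eq_mul,
      sum_apply, hθ0, hθi, heq y h1 h2]
    have h3 (i : Fin n) : g' 0 y (Pi.single i.succ 1) = g' i.succ y (Pi.single 0 1) :=
      hsymm y h1 h2 _ _
    simp only [h3, D, neg_add, Finset.sum_add_distrib, mul_add, Finset.mul_sum,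
      Finset.sum_neg_distrib, mul_neg, mul_sub, neg_sub]
    have h4 : ∑ i : Fin n, g 0 y * g i.succ y * (deriv expNegInvGlue (s y) * (2 * y i.succ)) =
        ∑ i : Fin n, deriv expNegInvGlue (s y) * (2 * (y i.succ * (g 0 y * g i.succ y))) :=
      Finset.sum_congr rfl fun i _ => by ring
    rw [h4]
    ring
  have hDc : ContinuousOn D (Set.Icc a b) := by
    have hφ : Continuous (deriv expNegInvGlue) :=
      (expNegInvGlue.contDiff (n := 1)).continuous_deriv le_rfl
    refine ((hφ.comp (by fun_prop : Continuous s)).continuousOn.mul (((by fun_prop :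
      Continuous fun y : Fin (n + 1) → ℝ => 2 * (R - y 0)).continuousOn.mul (hec.mono hsub)).sub
        (continuousOn_const.mul (continuousOn_finsetSum _ fun i _ =>
          (continuous_apply _).continuousOn.mul ((hgc 0).mul (hgc i.succ)))))).neg
  have hDle (y) (h : y 0 < T) : D y ≤ 0 := by
    have hφ : 0 ≤ deriv expNegInvGlue (s y) := expNegInvGlue.monotone.deriv_nonneg
    rcases le_or_gt (s y) 0 with h0 | h0
    · simp [D, deriv_expNegInvGlue_of_nonpos h0]
    · have := two_mul_sum_mul_mul_le (x := fun i : Fin n => y i.succ) (q := fun i => g i.succ y)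
        (p := g 0 y) (r := R - y 0) (by linarith) (by simp only [s] at h0; linarith)
      have h5 : 0 ≤ 2 * (R - y 0) * e y - 2 * ∑ i : Fin n, y i.succ * (g 0 y * g i.succ y) := by
        simp only [e]; linarith
      simp only [D]
      have := mul_nonneg hφ h5
      linarith
  have hae : (Set.univ.pi fun i => Set.Ioo (a i) (b i)) =ᵐ[volume] Set.Icc a b :=
    Measure.univ_pi_Ioo_ae_eq_Icc
  have hmeas : MeasurableSet (Set.univ.pi fun i => Set.Ioo (a i) (b i)) :=
    MeasurableSet.univ_pi fun i => measurableSet_Ioo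
  -- The individual derivatives `g'` need not be integrable, but their combination equals `D`, which
  -- is continuous on the closed box because it involves only `g`.
  have hI : IntegrableOn (fun y => ∑ i, F' i y (Pi.single i 1)) (Set.Icc a b) := by
    rw [← integrableOn_congr_set_ae hae]
    exact (((hDc.integrableOn_compact isCompact_Icc).congr_set_ae hae)).congr_fun
      (fun y hy => (hdiv y hy).symm) hmeas
  have key := integral_divergence_of_hasFDerivAt_off_countable' a b hab F F' ∅ Set.countable_empty
    hFc (fun y hy => hFd y hy.1) hI
  have hneg : ∫ y in Set.Icc a b, ∑ i, F' i y (Pi.single i 1) ≤ 0 := by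
    rw [← setIntegral_congr_set hae]
    exact setIntegral_nonpos hmeas fun y hy => (hdiv y hy).trans_le (hDle y (hint hy).2)
  rw [key, Fin.sum_univ_succ] at hneg
  have hae' : a ∘ Fin.succ = fun _ => -R := by ext; simp [a]
  have hbe' : b ∘ Fin.succ = fun _ => R := by ext; simp [b]
  -- On a lateral face `|x| ≥ R ≥ R - t`, so the cutoff vanishes; the hypothesis on `r` covers both
  -- faces `r = ±R`.
  have hside (i : Fin n) (r : ℝ) (hr : r ^ 2 = R ^ 2) (x : Fin n → ℝ)
      (hx : x ∈ Set.Icc (a ∘ i.succ.succAbove) (b ∘ i.succ.succAbove)) :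
      F i.succ (i.succ.insertNth r x) = 0 := by
    have hx0 : ∃ k, i.succ.succAbove k = 0 := by
      obtain ⟨k, hk⟩ := Fin.exists_succAbove_eq (Fin.succ_ne_zero i).symm
      exact ⟨k, hk⟩
    obtain ⟨k, hk⟩ := hx0
    have h1 : (i.succ.insertNth r x : Fin (n + 1) → ℝ) 0 = x k := by
      rw [← hk, Fin.insertNth_apply_succAbove]
    have h2 : 0 ≤ x k := by simpa [hk, a] using hx.1 k
    have h3 : x k ≤ T := by simpa [hk, b] using hx.2 k
    set z : Fin (n + 1) → ℝ := i.succ.insertNth r x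
    have h4 : R ^ 2 ≤ ∑ i : Fin n, z i.succ ^ 2 := by
      have : z i.succ ^ 2 = R ^ 2 := by simp [z, hr]
      rw [← this]
      exact Finset.single_le_sum (f := fun i : Fin n => z i.succ ^ 2)
        (fun i _ => sq_nonneg _) (Finset.mem_univ i)
    have h5 : θ z = 0 := expNegInvGlue.zero_of_nonpos (by rw [h1]; nlinarith)
    simp [F, h5]
  have hside' : ∑ i : Fin n, ((∫ x in Set.Icc (a ∘ i.succ.succAbove) (b ∘ i.succ.succAbove),
      F i.succ (i.succ.insertNth (b i.succ) x)) -
      ∫ x in Set.Icc (a ∘ i.succ.succAbove) (b ∘ i.succ.succAbove),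
        F i.succ (i.succ.insertNth (a i.succ) x)) = 0 := by
    refine Finset.sum_eq_zero fun i _ => ?_
    rw [setIntegral_eq_zero_of_forall_eq_zero (hside i _ (by simp [b])),
      setIntegral_eq_zero_of_forall_eq_zero (hside i _ (by simp [a])), sub_zero]
  have hF0 (r : ℝ) (x : Fin n → ℝ) : F 0 ((0 : Fin (n + 1)).insertNth r x) =
      θ (Fin.cons r x) * e (Fin.cons r x) := by
    simp [F]
  have hbase (x : Fin n → ℝ) : θ (Fin.cons 0 x) * e (Fin.cons 0 x) = 0 := by
    rcases lt_or_ge (∑ i, x i ^ 2) (R ^ 2) with h | h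
    · have := hinit (Fin.cons 0 x) rfl (by simpa using h)
      simp [e, this]
    · have : θ (Fin.cons 0 x) = 0 := expNegInvGlue.zero_of_nonpos (by simpa using h)
      simp [this]
  have ha0 : a 0 = 0 := rfl
  have hb0 : b 0 = T := rfl
  have hsa : (Fin.succAbove 0 : Fin n → Fin (n + 1)) = Fin.succ := by ext; simp
  rw [hside', add_zero, hsa, hae', hbe', ha0, hb0] at hneg
  simp only [hF0, hbase, integral_zero, sub_zero] at hneg
  have he0 (y) : 0 ≤ e y :=
    div_nonneg (add_nonneg (sq_nonneg _) (Finset.sum_nonneg fun i _ => sq_nonneg _)) two_pos.le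
  have hnn (x : Fin n → ℝ) : 0 ≤ θ (Fin.cons T x) * e (Fin.cons T x) :=
    mul_nonneg (expNegInvGlue.nonneg _) (he0 _)
  have hcons : Continuous fun x : Fin n → ℝ => (Fin.cons T x : Fin (n + 1) → ℝ) := by
    fun_prop
  have hcT : Continuous fun x : Fin n → ℝ => θ (Fin.cons T x) * e (Fin.cons T x) :=
    (hθc.comp hcons).mul (hec.comp_continuous hcons fun x => ⟨hT.le, le_rfl⟩)
  -- Only the top face is left: a nonnegative continuous function with nonpositive integral
  -- vanishes, and the cutoff is positive where `|x| < R - T`.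
  have hzero := (setIntegral_eq_zero_iff_of_nonneg_ae (Filter.Eventually.of_forall hnn)
    (hcT.continuousOn.integrableOn_compact isCompact_Icc)).1
    (le_antisymm hneg (integral_nonneg hnn))
  have hopen : IsOpen (Set.univ.pi fun _ : Fin n => Set.Ioo (-R) R) :=
    isOpen_set_pi Set.finite_univ fun _ _ => isOpen_Ioo
  have hEq : Set.EqOn (fun x : Fin n → ℝ => θ (Fin.cons T x) * e (Fin.cons T x)) 0
      (Set.univ.pi fun _ : Fin n => Set.Ioo (-R) R) := by
    refine Measure.eqOn_open_of_ae_eq (ae_restrict_of_ae_restrict_of_subset ?_ hzero) hopen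
      hcT.continuousOn continuousOn_const
    exact fun x hx => ⟨fun i => (hx i trivial).1.le, fun i => (hx i trivial).2.le⟩
  have hyc : y = Fin.cons T (Fin.tail y) := by rw [← hy0]; exact (Fin.cons_self_tail y).symm
  have hmem : Fin.tail y ∈ Set.univ.pi fun _ : Fin n => Set.Ioo (-R) R := by
    intro i _
    have : y i.succ ^ 2 < R ^ 2 := by
      refine ((Finset.single_le_sum (f := fun i : Fin n => y i.succ ^ 2)
        (fun i _ => sq_nonneg _) (Finset.mem_univ i)).trans_lt hy).trans ?_
      gcongr; linarith
    exact abs_lt.1 (abs_lt_of_sq_lt_sq this hR.le)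
  have hz := hEq hmem
  simp only [← hyc, Pi.zero_apply] at hz
  have hθpos : 0 < θ y := expNegInvGlue.pos_of_pos (by rw [hy0]; linarith)
  have hey : e y = 0 := (mul_eq_zero.1 hz).resolve_left hθpos.ne'
  have hsum : ∑ j, g j y ^ 2 = 0 := by
    rw [Fin.sum_univ_succ]
    simp only [e] at hey
    linarith
  exact pow_eq_zero_iff two_ne_zero |>.1
    ((Finset.sum_eq_zero_iff_of_nonneg fun i _ => sq_nonneg _).1 hsum j (Finset.mem_univ j))

/-! ### Calculus of directional derivatives -/

/-- The derivative of `f` in the direction `v`. -/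
noncomputable def dirDeriv {E F : Type*} [NormedAddCommGroup E] [NormedSpace ℝ E]
    [NormedAddCommGroup F] [NormedSpace ℝ F] (v : E) (f : E → F) : E → F :=
  fun z => fderiv ℝ f z v

section DirDeriv

variable {E F G : Type*} [NormedAddCommGroup E] [NormedSpace ℝ E]
  [NormedAddCommGroup F] [NormedSpace ℝ F] [NormedAddCommGroup G] [NormedSpace ℝ G]

theorem ContDiff.dirDeriv {f : E → F} (hf : ContDiff ℝ ∞ f) (v : E) :
    ContDiff ℝ ∞ (dirDeriv v f) :=
  (hf.fderiv_right (m := ∞) (by simp)).clm_apply contDiff_const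

theorem HasFDerivAt.apply_const {A : E → F →L[ℝ] G} {A' : E →L[ℝ] F →L[ℝ] G} {z : E}
    (h : HasFDerivAt A A' z) (v : F) : HasFDerivAt (fun y => A y v) (A'.flip v) z :=
  (h.clm_apply (hasFDerivAt_const v z)).congr_fderiv (by ext u; simp)

theorem dirDeriv_dirDeriv_eq {f : E → F} (hf : ContDiff ℝ ∞ f) (v w z : E) :
    dirDeriv v (dirDeriv w f) z = fderiv ℝ (fderiv ℝ f) z v w := by
  have h1 : HasFDerivAt (fderiv ℝ f) (fderiv ℝ (fderiv ℝ f) z) z :=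
    ((hf.fderiv_right (m := ∞) (by simp)).differentiable (by simp) z).hasFDerivAt
  have h2 : HasFDerivAt (dirDeriv w f) ((fderiv ℝ (fderiv ℝ f) z).flip w) z :=
    h1.apply_const w
  rw [dirDeriv, h2.fderiv, ContinuousLinearMap.flip_apply]

theorem dirDeriv_comm {f : E → F} (hf : ContDiff ℝ ∞ f) (v w : E) :
    dirDeriv v (dirDeriv w f) = dirDeriv w (dirDeriv v f) := by
  ext z
  rw [dirDeriv_dirDeriv_eq hf, dirDeriv_dirDeriv_eq hf]
  exact (hf.contDiffAt.isSymmSndFDerivAt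
    (by simpa using WithTop.coe_le_coe.2 (le_top (a := (2 : ℕ∞))))).eq v w

theorem dirDeriv_add {f g : E → F} (hf : ContDiff ℝ ∞ f) (hg : ContDiff ℝ ∞ g) (v : E) :
    dirDeriv v (f + g) = dirDeriv v f + dirDeriv v g := by
  ext z
  simp [dirDeriv, fderiv_add (hf.differentiable (by simp) z) (hg.differentiable (by simp) z)]

theorem dirDeriv_clm_comp {f : E → F} (hf : ContDiff ℝ ∞ f) (A : F →L[ℝ] G) (v : E) :
    dirDeriv v (A ∘ f) = A ∘ dirDeriv v f := by
  ext z
  simp [dirDeriv, (A.hasFDerivAt.comp z (hf.differentiable (by simp) z).hasFDerivAt).fderiv]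

theorem dirDeriv_comp_clm {f : F → G} (hf : ContDiff ℝ ∞ f) (A : E →L[ℝ] F) (v : E) :
    dirDeriv v (f ∘ A) = dirDeriv (A v) f ∘ A := by
  ext z
  simp [dirDeriv, ((hf.differentiable (by simp) (A z)).hasFDerivAt.comp z A.hasFDerivAt).fderiv]

theorem dirDeriv_smul_left (c : ℝ) (f : E → F) (v : E) :
    dirDeriv (c • v) f = c • dirDeriv v f := by
  ext z
  simp [dirDeriv]

theorem dirDeriv_const_smul {f : E → F} (hf : ContDiff ℝ ∞ f) (c : ℝ) (v : E) :
    dirDeriv v (c • f) = c • dirDeriv v f := by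
  ext z
  simp [dirDeriv, fderiv_const_smul (hf.differentiable (by simp) z)]

end DirDeriv

/-! ### Smooth parameter integrals and primitives in time -/

section Primitive

/-- Differentiation under the integral sign over `[0, 1]`. -/
theorem hasFDerivAt_integral_unitInterval {E F : Type} [NormedAddCommGroup E] [NormedSpace ℝ E]
    [ProperSpace E] [NormedAddCommGroup F] [NormedSpace ℝ F]
    {f : E × ℝ → F} (hf : ContDiff ℝ 1 f) (x : E) :
    HasFDerivAt (fun x => ∫ s in (0 : ℝ)..1, f (x, s))
      (∫ s in (0 : ℝ)..1, (fderiv ℝ f (x, s)).comp (ContinuousLinearMap.inl ℝ E ℝ)) x := by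
  have hf' : Continuous fun p : E × ℝ => (fderiv ℝ f p).comp (ContinuousLinearMap.inl ℝ E ℝ) :=
    (hf.continuous_fderiv (by simp)).clm_comp continuous_const
  obtain ⟨C, hC⟩ := ((isCompact_closedBall x 1).prod
    (isCompact_Icc (a := (0 : ℝ)) (b := 1))).exists_bound_of_continuousOn hf'.continuousOn
  refine intervalIntegral.hasFDerivAt_integral_of_dominated_of_fderiv_le (bound := fun _ => C)
    (F' := fun y s => (fderiv ℝ f (y, s)).comp (ContinuousLinearMap.inl ℝ E ℝ))
    (Metric.closedBall_mem_nhds x one_pos) (Filter.Eventually.of_forall fun y => ?_) ?_ ?_ ?_ ?_ ?_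
  · exact (hf.continuous.comp (by fun_prop)).aestronglyMeasurable
  · exact (hf.continuous.comp (by fun_prop)).intervalIntegrable _ _
  · exact (hf'.comp (by fun_prop : Continuous fun s : ℝ => (x, s))).aestronglyMeasurable
  · refine Filter.Eventually.of_forall fun s hs y hy => hC (y, s) ⟨hy, ?_⟩
    rw [Set.uIoc_of_le zero_le_one] at hs
    exact ⟨hs.1.le, hs.2⟩
  · exact intervalIntegrable_const
  · refine Filter.Eventually.of_forall fun s _ y _ => ?_
    exact (hf.differentiable (by simp) (y, s)).hasFDerivAt.comp y (hasFDerivAt_prodMk_left y s)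

/-- The derivative is again an integral of this kind, with values in `E →L[ℝ] F`. The induction
therefore varies `F`, and both spaces live in one universe. -/
theorem contDiff_integral_unitInterval_nat (k : ℕ) {E F : Type} [NormedAddCommGroup E]
    [NormedSpace ℝ E] [ProperSpace E] [NormedAddCommGroup F] [NormedSpace ℝ F]
    {f : E × ℝ → F} (hf : ContDiff ℝ ∞ f) :
    ContDiff ℝ k fun x => ∫ s in (0 : ℝ)..1, f (x, s) := by
  have h1 := fun x => hasFDerivAt_integral_unitInterval (hf.of_le (by simp)) x
  induction k generalizing F with
  | zero => exact contDiff_zero.2 (continuous_iff_continuousAt.2 fun x => (h1 x).continuousAt)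
  | succ k ih =>
    have hf' : ContDiff ℝ ∞ fun p : E × ℝ =>
        (fderiv ℝ f p).comp (ContinuousLinearMap.inl ℝ E ℝ) :=
      (hf.fderiv_right (m := ∞) (by simp)).clm_comp contDiff_const
    push_cast
    rw [contDiff_succ_iff_fderiv]
    refine ⟨fun x => (h1 x).differentiableAt, by simp, ?_⟩
    rw [funext fun x => (h1 x).fderiv]
    exact ih hf' fun x => hasFDerivAt_integral_unitInterval (hf'.of_le (by simp)) x

theorem contDiff_integral_unitInterval {E F : Type} [NormedAddCommGroup E] [NormedSpace ℝ E]
    [ProperSpace E] [NormedAddCommGroup F] [NormedSpace ℝ F]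
    {f : E × ℝ → F} (hf : ContDiff ℝ ∞ f) :
    ContDiff ℝ ∞ fun x => ∫ s in (0 : ℝ)..1, f (x, s) :=
  contDiff_infty.2 fun k => contDiff_integral_unitInterval_nat k hf

/-- The primitive of `f` in the first variable that vanishes at `0`. -/
noncomputable def timePrimitive {E : Type} (f : ℝ × E → ℝ) : ℝ × E → ℝ :=
  fun z => ∫ s in (0 : ℝ)..z.1, f (s, z.2)

variable {E : Type} [NormedAddCommGroup E] [NormedSpace ℝ E]

theorem contDiff_timePrimitive [ProperSpace E] {f : ℝ × E → ℝ} (hf : ContDiff ℝ ∞ f) :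
    ContDiff ℝ ∞ (timePrimitive f) := by
  -- Rescaling to `[0, 1]` moves the variable limit of integration into the integrand; this is valid
  -- for every sign of `z.1`.
  have h : timePrimitive f = fun z => z.1 * ∫ s in (0 : ℝ)..1, f (z.1 * s, z.2) := by
    ext z
    have := intervalIntegral.smul_integral_comp_mul_left (a := 0) (b := 1)
      (fun s => f (s, z.2)) z.1
    simpa [timePrimitive] using this.symm
  rw [h]
  exact contDiff_fst.mul (contDiff_integral_unitInterval
    (f := fun p : (ℝ × E) × ℝ => f (p.1.1 * p.2, p.1.2)) (hf.comp (by fun_prop)))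

theorem deriv_time_eq {f : ℝ × E → ℝ} (hf : ContDiff ℝ ∞ f) (t : ℝ) (x : E) :
    HasDerivAt (fun s => f (s, x)) (dirDeriv (1, 0) f (t, x)) t :=
  (hf.differentiable (by simp) (t, x)).hasFDerivAt.comp_hasDerivAt t
    ((hasDerivAt_id t).prodMk (hasDerivAt_const t x))

theorem dirDeriv_timePrimitive [ProperSpace E] {f : ℝ × E → ℝ} (hf : ContDiff ℝ ∞ f) :
    dirDeriv (1, 0) (timePrimitive f) = f := by
  ext ⟨t, x⟩
  have hc : Continuous fun s => f (s, x) := hf.continuous.comp (by fun_prop)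
  exact (deriv_time_eq (contDiff_timePrimitive hf) t x).unique
    (intervalIntegral.integral_hasDerivAt_right (hc.intervalIntegrable _ _)
      hc.aestronglyMeasurable.stronglyMeasurableAtFilter hc.continuousAt)

theorem dirDeriv_space_eq_zero {f : ℝ × E → ℝ} (hf : ContDiff ℝ ∞ f)
    (h0 : ∀ x, f (0, x) = 0) (v x : E) : dirDeriv (0, v) f (0, x) = 0 := by
  have h1 : HasFDerivAt (fun y : E => f (0, y))
      ((fderiv ℝ f (0, x)).comp (ContinuousLinearMap.inr ℝ ℝ E)) x :=
    (hf.differentiable (by simp) (0, x)).hasFDerivAt.comp x (hasFDerivAt_prodMk_right 0 x)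
  simp only [h0] at h1
  have h2 := congrArg (fun A : E →L[ℝ] ℝ => A v) (h1.unique (hasFDerivAt_const (0 : ℝ) x))
  simpa [dirDeriv] using h2

theorem eq_zero_of_dirDeriv_time {f : ℝ × E → ℝ} (hf : ContDiff ℝ ∞ f)
    (h0 : ∀ x, f (0, x) = 0) (h : ∀ z, dirDeriv (1, 0) f z = 0) (z : ℝ × E) : f z = 0 := by
  have h1 := is_const_of_deriv_eq_zero (f := fun s => f (s, z.2))
    (fun t => (deriv_time_eq hf t z.2).differentiableAt)
    (fun t => by rw [(deriv_time_eq hf t z.2).deriv, h]) z.1 0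
  rw [← h0 z.2]
  exact h1

end Primitive

/-! ### The wave operator -/

section WaveOperator

variable {n : ℕ} {F : Type*} [NormedAddCommGroup F] [NormedSpace ℝ F]

/-- The direction of the `i`-th space coordinate in `ℝ × ℝⁿ`. -/
noncomputable def spaceDir (i : Fin n) : ℝ × EuclideanSpace ℝ (Fin n) :=
  (0, EuclideanSpace.single i 1)

/-- The wave operator `∂²/∂t² - Δ`. -/
noncomputable def waveOp (f : ℝ × EuclideanSpace ℝ (Fin n) → F) :
    ℝ × EuclideanSpace ℝ (Fin n) → F :=
  dirDeriv (1, 0) (dirDeriv (1, 0) f) - ∑ i, dirDeriv (spaceDir i) (dirDeriv (spaceDir i) f)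

theorem waveOp_add {f g : ℝ × EuclideanSpace ℝ (Fin n) → F} (hf : ContDiff ℝ ∞ f)
    (hg : ContDiff ℝ ∞ g) : waveOp (f + g) = waveOp f + waveOp g := by
  have h (v) : dirDeriv v (dirDeriv v (f + g)) =
      dirDeriv v (dirDeriv v f) + dirDeriv v (dirDeriv v g) := by
    rw [dirDeriv_add hf hg, dirDeriv_add (hf.dirDeriv v) (hg.dirDeriv v)]
  simp only [waveOp, h, Finset.sum_add_distrib]
  abel

theorem waveOp_clm_comp {G : Type*} [NormedAddCommGroup G] [NormedSpace ℝ G]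
    {f : ℝ × EuclideanSpace ℝ (Fin n) → F} (hf : ContDiff ℝ ∞ f) (A : F →L[ℝ] G) :
    waveOp (A ∘ f) = A ∘ waveOp f := by
  have h (v) : dirDeriv v (dirDeriv v (A ∘ f)) = A ∘ dirDeriv v (dirDeriv v f) := by
    rw [dirDeriv_clm_comp hf, dirDeriv_clm_comp (hf.dirDeriv v)]
  ext z
  simp [waveOp, h]

/-- The time derivative of `waveOp (timePrimitive f)` is `waveOp f = 0`. At `t = 0` the primitive
and its space derivatives vanish, leaving the time derivative of `f`, which is zero there by `h0`.
-/
theorem waveOp_timePrimitive {f : ℝ × EuclideanSpace ℝ (Fin n) → ℝ} (hf : ContDiff ℝ ∞ f)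
    (hw : waveOp f = 0) (h0 : ∀ x, dirDeriv (1, 0) f (0, x) = 0) :
    waveOp (timePrimitive f) = 0 := by
  have hP := contDiff_timePrimitive hf
  have h1 (v) : dirDeriv (1, 0) (dirDeriv v (dirDeriv v (timePrimitive f))) =
      dirDeriv v (dirDeriv v f) := by
    rw [dirDeriv_comm (hP.dirDeriv v), dirDeriv_comm hP, dirDeriv_timePrimitive hf]
  have hs (i : Fin n) : ContDiff ℝ ∞ (dirDeriv (spaceDir i) (dirDeriv (spaceDir i)
      (timePrimitive f))) := (hP.dirDeriv _).dirDeriv _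
  have hsum : ContDiff ℝ ∞ (∑ i : Fin n, dirDeriv (spaceDir i) (dirDeriv (spaceDir i)
      (timePrimitive f))) := by
    rw [Finset.sum_fn]
    exact ContDiff.sum fun i _ => hs i
  have hW : ContDiff ℝ ∞ (waveOp (timePrimitive f)) :=
    ((hP.dirDeriv _).dirDeriv _).sub hsum
  ext z
  refine eq_zero_of_dirDeriv_time hW (fun x => ?_) (fun z => ?_) z
  · have h2 (i : Fin n) : dirDeriv (spaceDir i) (dirDeriv (spaceDir i) (timePrimitive f)) (0, x)
        = 0 := dirDeriv_space_eq_zero (hP.dirDeriv _)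
      (fun y => dirDeriv_space_eq_zero hP (fun y => by simp [timePrimitive]) _ y) _ x
    simp [waveOp, h2, dirDeriv_timePrimitive hf, h0]
  · rw [← Pi.zero_apply (M := fun _ => ℝ) z, ← hw]
    simp only [waveOp]
    have hd (g : ℝ × EuclideanSpace ℝ (Fin n) → ℝ) (hg : ContDiff ℝ ∞ g) :
      DifferentiableAt ℝ g z := hg.differentiable (by simp) z
    rw [dirDeriv, fderiv_sub (hd _ ((hP.dirDeriv _).dirDeriv _)) (hd _ hsum),
      fderiv_sum fun i _ => hd _ (hs i)]
    have h3 (v : ℝ × EuclideanSpace ℝ (Fin n)) :=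
      congrFun (h1 v) z
    simp only [dirDeriv] at h3
    simp [sub_apply, sum_apply, dirDeriv, h3]

end WaveOperator

/-! ### Differentiating Fourier integrals of rapidly decaying functions -/

section FourierIntegral

variable {V W : Type*} [NormedAddCommGroup V] [MeasurableSpace V]

/-- The function `a` and all its products with polynomials are integrable. -/
def HasFiniteMoments (μ : Measure V) (a : V → ℂ) : Prop :=
  AEStronglyMeasurable a μ ∧ ∀ k : ℕ, Integrable (fun v => ‖v‖ ^ k * ‖a v‖) μ

theorem HasFiniteMoments.integrable {μ : Measure V} {a : V → ℂ} (ha : HasFiniteMoments μ a) :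
    Integrable a μ :=
  (integrable_norm_iff ha.1).1 (by simpa using ha.2 0)

variable [NormedSpace ℝ V] [BorelSpace V]

theorem HasFiniteMoments.smul {μ : Measure V} {a : V → ℂ} (ha : HasFiniteMoments μ a)
    (c : ℂ) (A : V →L[ℝ] ℝ) : HasFiniteMoments μ fun v => c • A v • a v := by
  have hm : AEStronglyMeasurable (fun v => c • A v • a v) μ :=
    (A.continuous.aestronglyMeasurable.smul ha.1).const_smul c
  refine ⟨hm, fun k => ((ha.2 (k + 1)).const_mul (‖c‖ * ‖A‖)).mono'
    ((by fun_prop : Continuous fun v : V => ‖v‖ ^ k).aestronglyMeasurable.mul hm.norm)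
    (Filter.Eventually.of_forall fun v => ?_)⟩
  rw [norm_smul, norm_smul, Real.norm_of_nonneg (by positivity)]
  calc ‖v‖ ^ k * (‖c‖ * (‖A v‖ * ‖a v‖))
      ≤ ‖v‖ ^ k * (‖c‖ * ((‖A‖ * ‖v‖) * ‖a v‖)) := by gcongr; exact A.le_opNorm v
    _ = ‖c‖ * ‖A‖ * (‖v‖ ^ (k + 1) * ‖a v‖) := by ring

variable [SecondCountableTopology V] [NormedAddCommGroup W] [NormedSpace ℝ W]

theorem HasFiniteMoments.contDiff_fourierIntegral {μ : Measure V} {a : V → ℂ}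
    (ha : HasFiniteMoments μ a) (L : V →L[ℝ] W →L[ℝ] ℝ) :
    ContDiff ℝ ∞ (VectorFourier.fourierIntegral 𝐞 μ L.toLinearMap₁₂ a) :=
  VectorFourier.contDiff_fourierIntegral L fun k _ => ha.2 k

theorem HasFiniteMoments.dirDeriv_fourierIntegral {μ : Measure V} {a : V → ℂ}
    (ha : HasFiniteMoments μ a) (L : V →L[ℝ] W →L[ℝ] ℝ) (w : W) :
    dirDeriv w (VectorFourier.fourierIntegral 𝐞 μ L.toLinearMap₁₂ a) =
      VectorFourier.fourierIntegral 𝐞 μ L.toLinearMap₁₂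
        fun v => (-(2 * Real.pi * Complex.I)) • L.flip w v • a v := by
  have h1 : Integrable (fun v => ‖v‖ * ‖a v‖) μ := by simpa using ha.2 1
  ext z
  rw [dirDeriv, VectorFourier.fderiv_fourierIntegral L ha.integrable h1,
    Real.fourierIntegral_continuousLinearMap_apply']
  · rfl
  · refine (h1.const_mul (2 * Real.pi * ‖L‖)).mono' ha.1.fourierSMulRight
      (Filter.Eventually.of_forall fun v => ?_)
    rw [← mul_assoc]
    exact VectorFourier.norm_fourierSMulRight_le L a v

end FourierIntegral

/-! ### Fourier integrals over the light cone -/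

section Cone

variable {n : ℕ}

/-- Minus the standard pairing on `ℝ × ℝⁿ`. -/
noncomputable def spacetimePairing (n : ℕ) :
    ℝ × EuclideanSpace ℝ (Fin n) →L[ℝ] ℝ × EuclideanSpace ℝ (Fin n) →L[ℝ] ℝ :=
  -((ContinuousLinearMap.mul ℝ ℝ).bilinearComp (ContinuousLinearMap.fst ℝ _ _)
      (ContinuousLinearMap.fst ℝ _ _) +
    (innerSL ℝ).bilinearComp (ContinuousLinearMap.snd ℝ _ _) (ContinuousLinearMap.snd ℝ _ _))

theorem spacetimePairing_apply (v z : ℝ × EuclideanSpace ℝ (Fin n)) :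
    spacetimePairing n v z = -(v.1 * z.1 + ⟪v.2, z.2⟫) := by
  simp [spacetimePairing]

/-- The image of Lebesgue measure on the forward light cone in frequency space. -/
noncomputable def coneMeasure (n : ℕ) : Measure (ℝ × EuclideanSpace ℝ (Fin n)) :=
  Measure.map (fun ξ => (‖ξ‖, ξ)) volume

theorem ae_coneMeasure : ∀ᵐ v ∂coneMeasure n, v.1 = ‖v.2‖ := by
  rw [coneMeasure, ae_map_iff (by fun_prop) (measurableSet_eq_fun (by fun_prop) (by fun_prop))]
  simp

/-- On the Fourier side the operator multiplies by `(2πi)²(τ² - |ξ|²)`, which vanishes on the cone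
carrying the measure. Smoothness of `|ξ|` at the origin plays no role. -/
theorem waveOp_fourierIntegral_coneMeasure {a : ℝ × EuclideanSpace ℝ (Fin n) → ℂ}
    (ha : HasFiniteMoments (coneMeasure n) a) :
    waveOp (VectorFourier.fourierIntegral 𝐞 (coneMeasure n) (spacetimePairing n).toLinearMap₁₂ a)
      = 0 := by
  have h (w : ℝ × EuclideanSpace ℝ (Fin n)) := ha.dirDeriv_fourierIntegral (spacetimePairing n) w
  have h' (w : ℝ × EuclideanSpace ℝ (Fin n)) :=
    (ha.smul (-(2 * Real.pi * Complex.I)) ((spacetimePairing n).flip w)).dirDeriv_fourierIntegral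
      (spacetimePairing n) w
  ext z
  simp only [waveOp, h, h', Pi.sub_apply, Finset.sum_apply, Pi.zero_apply, sub_eq_zero]
  simp only [VectorFourier.fourierIntegral]
  rw [← integral_finsetSum]
  · refine integral_congr_ae ?_
    filter_upwards [ae_coneMeasure] with v hv
    rw [← Finset.smul_sum]
    congr 1
    have hn : ‖v.2‖ ^ 2 = ∑ i, v.2 i ^ 2 := by
      simp [EuclideanSpace.norm_sq_eq]
    have hn' : (‖v.2‖ : ℂ) ^ 2 = ∑ i, (v.2 i : ℂ) ^ 2 := by exact_mod_cast hn
    simp only [ContinuousLinearMap.flip_apply, spacetimePairing_apply, spaceDir]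
    simp [EuclideanSpace.inner_single_right, hv]
    calc _ = (2 * Real.pi * Complex.I) ^ 2 * a v * (‖v.2‖ : ℂ) ^ 2 := by ring
      _ = _ := by
        rw [hn', Finset.mul_sum]
        exact Finset.sum_congr rfl fun i _ => by ring
  · intro i _
    exact (VectorFourier.fourierIntegral_convergent_iff Real.continuous_fourierChar
      (spacetimePairing n).continuous₂ z).2
      ((ha.smul _ ((spacetimePairing n).flip (spaceDir i))).smul _
        ((spacetimePairing n).flip (spaceDir i))).integrable

/-- In the maximum norm `(‖ξ‖, ξ)` has norm `‖ξ‖`, so these are the usual Schwartz moments. -/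
theorem hasFiniteMoments_coneMeasure (f : 𝓢(EuclideanSpace ℝ (Fin n), ℂ)) :
    HasFiniteMoments (coneMeasure n) fun v => f v.2 := by
  have hm : Measurable fun ξ : EuclideanSpace ℝ (Fin n) => (‖ξ‖, ξ) := by fun_prop
  have hc : Continuous fun v : ℝ × EuclideanSpace ℝ (Fin n) => f v.2 :=
    f.continuous.comp continuous_snd
  refine ⟨hc.aestronglyMeasurable, fun k => ?_⟩
  rw [coneMeasure, integrable_map_measure (by fun_prop) hm.aemeasurable]
  simpa [Function.comp_def, Prod.norm_def] using f.integrable_pow_mul volume k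

/-- At time zero this is the inverse Fourier integral: the sign in `spacetimePairing` cancels the
one in the Fourier kernel. -/
theorem fourierIntegral_coneMeasure_zero (f : 𝓢(EuclideanSpace ℝ (Fin n), ℂ))
    (x : EuclideanSpace ℝ (Fin n)) :
    VectorFourier.fourierIntegral 𝐞 (coneMeasure n) (spacetimePairing n).toLinearMap₁₂
      (fun v => 𝓕 f v.2) (0, x) = f x := by
  have hf : f = 𝓕⁻ (𝓕 f) := by simp
  conv_rhs => rw [hf]
  rw [SchwartzMap.fourierInv_coe, Real.fourierInv_eq, VectorFourier.fourierIntegral, coneMeasure,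
    integral_map (by fun_prop)]
  · simp [spacetimePairing_apply]
  · exact ((VectorFourier.fourierIntegral_convergent_iff Real.continuous_fourierChar
      (spacetimePairing n).continuous₂ (0, x)).2 (hasFiniteMoments_coneMeasure (𝓕 f)).integrable).1

end Cone

/-! ### Smooth solutions with compactly supported data -/

section Existence

variable {n : ℕ}

/-- The time reflection `(t, x) ↦ (-t, x)`. -/
noncomputable def timeReflection (E : Type*) [NormedAddCommGroup E] [NormedSpace ℝ E] :
    ℝ × E →L[ℝ] ℝ × E :=
  (-ContinuousLinearMap.fst ℝ ℝ E).prod (ContinuousLinearMap.snd ℝ ℝ E)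

@[simp] theorem timeReflection_apply {E : Type*} [NormedAddCommGroup E] [NormedSpace ℝ E]
    (z : ℝ × E) : timeReflection E z = (-z.1, z.2) := rfl

theorem waveOp_comp_timeReflection {f : ℝ × EuclideanSpace ℝ (Fin n) → ℝ} (hf : ContDiff ℝ ∞ f) :
    waveOp (f ∘ timeReflection _) = waveOp f ∘ timeReflection _ := by
  have h (v) : dirDeriv v (dirDeriv v (f ∘ timeReflection _)) =
      dirDeriv (timeReflection _ v) (dirDeriv (timeReflection _ v) f) ∘ timeReflection _ := by
    rw [dirDeriv_comp_clm hf, dirDeriv_comp_clm (hf.dirDeriv _)]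
  have h0 : timeReflection (EuclideanSpace ℝ (Fin n)) (1, 0) = (-1 : ℝ) • (1, 0) := by simp
  have hi (i : Fin n) : timeReflection (EuclideanSpace ℝ (Fin n)) (spaceDir i) = spaceDir i := by
    simp [spaceDir]
  ext z
  simp only [waveOp, h, h0, hi, dirDeriv_smul_left, dirDeriv_const_smul (hf.dirDeriv _)]
  simp

theorem exists_wave_zero_velocity {f : EuclideanSpace ℝ (Fin n) → ℝ} (hf : ContDiff ℝ ∞ f)
    (hs : HasCompactSupport f) : ∃ w : ℝ × EuclideanSpace ℝ (Fin n) → ℝ,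
      ContDiff ℝ ∞ w ∧ waveOp w = 0 ∧ (∀ x, w (0, x) = f x) ∧
        ∀ x, dirDeriv (1, 0) w (0, x) = 0 := by
  let fS : 𝓢(EuclideanSpace ℝ (Fin n), ℂ) :=
    (hs.comp_left (g := Complex.ofRealCLM) (by simp)).toSchwartzMap
      (Complex.ofRealCLM.contDiff.comp hf)
  have ha := hasFiniteMoments_coneMeasure (𝓕 fS)
  set W := VectorFourier.fourierIntegral 𝐞 (coneMeasure n) (spacetimePairing n).toLinearMap₁₂
      (fun v => 𝓕 fS v.2)
  have hWc : ContDiff ℝ ∞ W := ha.contDiff_fourierIntegral _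
  have hW0 : waveOp W = 0 := waveOp_fourierIntegral_coneMeasure ha
  -- The factor `1 / 2` prepares for adding the time reflection, which doubles the value at `t = 0`
  -- and cancels the velocity.
  set U : ℝ × EuclideanSpace ℝ (Fin n) → ℝ := ((1 / 2 : ℝ) • Complex.reCLM) ∘ W with hU
  have hUc : ContDiff ℝ ∞ U := ContinuousLinearMap.contDiff _ |>.comp hWc
  have hU0 : waveOp U = 0 := by
    rw [hU, waveOp_clm_comp hWc, hW0]; ext; simp
  have hUi (x) : U (0, x) = f x / 2 := by
    have : W (0, x) = f x := fourierIntegral_coneMeasure_zero fS x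
    simp [U, this]
    ring
  have hR : ContDiff ℝ ∞ (U ∘ timeReflection _) := hUc.comp (timeReflection (EuclideanSpace ℝ (Fin n))).contDiff
  refine ⟨U + U ∘ timeReflection _, hUc.add hR, ?_, fun x => ?_, fun x => ?_⟩
  · rw [waveOp_add hUc hR, waveOp_comp_timeReflection hUc, hU0]
    ext
    simp
  · simp [hUi]
  · have h0 : timeReflection (EuclideanSpace ℝ (Fin n)) (1, 0) = (-1 : ℝ) • (1, 0) := by simp
    rw [dirDeriv_add hUc hR, dirDeriv_comp_clm hUc, h0, dirDeriv_smul_left]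
    simp

/-- Smooth compactly supported initial data have a smooth global solution. -/
theorem exists_wave {f g : EuclideanSpace ℝ (Fin n) → ℝ} (hf : ContDiff ℝ ∞ f)
    (hfs : HasCompactSupport f) (hg : ContDiff ℝ ∞ g) (hgs : HasCompactSupport g) :
    ∃ w : ℝ × EuclideanSpace ℝ (Fin n) → ℝ, ContDiff ℝ ∞ w ∧ waveOp w = 0 ∧
      (∀ x, w (0, x) = f x) ∧ ∀ x, dirDeriv (1, 0) w (0, x) = g x := by
  obtain ⟨u, hu, hu0, huf, huv⟩ := exists_wave_zero_velocity hf hfs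
  obtain ⟨v, hv, hv0, hvg, hvv⟩ := exists_wave_zero_velocity hg hgs
  have hP := contDiff_timePrimitive hv
  refine ⟨u + timePrimitive v, hu.add hP, ?_, fun x => ?_, fun x => ?_⟩
  · rw [waveOp_add hu hP, hu0, waveOp_timePrimitive hv hv0 hvv, add_zero]
  · simp [huf, timePrimitive]
  · rw [dirDeriv_add hu hP, dirDeriv_timePrimitive hv]
    simp [huv, hvg]

end Existence

/-! ### Finite propagation speed for classical solutions -/

section Uniqueness

variable {n : ℕ}

/-- The coordinates `(σ t, x)` on `ℝ × ℝⁿ`. -/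
noncomputable def spacetimeCoord (n : ℕ) (σ : ℝ) :
    (Fin (n + 1) → ℝ) →L[ℝ] ℝ × EuclideanSpace ℝ (Fin n) :=
  (σ • ContinuousLinearMap.proj 0).prod
    ((EuclideanSpace.equiv (Fin n) ℝ).symm.toContinuousLinearMap.comp
      (ContinuousLinearMap.pi fun i => ContinuousLinearMap.proj i.succ))

theorem spacetimeCoord_apply (σ : ℝ) (y : Fin (n + 1) → ℝ) :
    spacetimeCoord n σ y = (σ * y 0, WithLp.toLp 2 fun i => y i.succ) := rfl

theorem spacetimeCoord_single_zero (σ : ℝ) :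
    spacetimeCoord n σ (Pi.single 0 1) = σ • (1, 0) := by
  simp only [spacetimeCoord_apply]
  ext <;> simp

theorem spacetimeCoord_single_succ (σ : ℝ) (i : Fin n) :
    spacetimeCoord n σ (Pi.single i.succ 1) = spaceDir i := by
  simp only [spacetimeCoord_apply, spaceDir]
  ext j
  · simp
  · simp [Pi.single_apply]

/-- Domain of dependence for closed covector fields satisfying the wave equation. The sign `σ`
is the direction of time. -/
theorem time_component_eq_zero {σ T R : ℝ} (hσ : σ * σ = 1) (hT : 0 < T)
    {G : ℝ × EuclideanSpace ℝ (Fin n) → ℝ × EuclideanSpace ℝ (Fin n) →L[ℝ] ℝ}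
    {H : ℝ × EuclideanSpace ℝ (Fin n) →
      ℝ × EuclideanSpace ℝ (Fin n) →L[ℝ] ℝ × EuclideanSpace ℝ (Fin n) →L[ℝ] ℝ}
    (hc : ContinuousOn G {z | 0 ≤ σ * z.1 ∧ σ * z.1 ≤ T})
    (hd : ∀ z, 0 < σ * z.1 → σ * z.1 < T → HasFDerivAt G (H z) z)
    (hsymm : ∀ z, 0 < σ * z.1 → σ * z.1 < T → ∀ v w, H z v w = H z w v)
    (heq : ∀ z, 0 < σ * z.1 → σ * z.1 < T →
      H z (1, 0) (1, 0) = ∑ i, H z (spaceDir i) (spaceDir i))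
    (hinit : ∀ x, ‖x‖ < R → G (0, x) = 0) {z : ℝ × EuclideanSpace ℝ (Fin n)}
    (hz : σ * z.1 = T) (hzR : ‖z.2‖ < R - T) : G z (1, 0) = 0 := by
  set Φ := spacetimeCoord n σ
  have hTR : T < R := by linarith [norm_nonneg z.2]
  have hΦ1 (y : Fin (n + 1) → ℝ) : σ * (Φ y).1 = y 0 := by
    simp [Φ, spacetimeCoord_apply, ← mul_assoc, hσ]
  have hΦ2 (y : Fin (n + 1) → ℝ) : ‖(Φ y).2‖ ^ 2 = ∑ i : Fin n, y i.succ ^ 2 := by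
    simp [Φ, spacetimeCoord_apply, EuclideanSpace.norm_sq_eq]
  set y₀ : Fin (n + 1) → ℝ := Fin.cons T z.2
  have hΦz : Φ y₀ = z := by
    simp only [Φ, spacetimeCoord_apply, y₀, ← hz]
    ext i
    · simp [← mul_assoc, hσ]
    · simp
  have key := eq_zero_of_wave_gradient hT hTR
    (g := fun j y => G (Φ y) (Φ (Pi.single j 1)))
    (g' := fun j y => ((H (Φ y)).flip (Φ (Pi.single j 1))).comp Φ)
    (fun j => (hc.comp Φ.continuous.continuousOn fun y hy => by
      simpa [hΦ1] using hy).clm_apply continuousOn_const)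
    (fun j y h0 h1 => by
      exact ((hd (Φ y) (by rwa [hΦ1]) (by rwa [hΦ1])).apply_const _).comp y Φ.hasFDerivAt)
    (fun y h0 h1 i j => by
      simpa using hsymm (Φ y) (by rwa [hΦ1]) (by rwa [hΦ1]) _ _)
    (fun y h0 h1 => by
      have := heq (Φ y) (by rwa [hΦ1]) (by rwa [hΦ1])
      simp only [ContinuousLinearMap.comp_apply, ContinuousLinearMap.flip_apply]
      simp only [Φ, spacetimeCoord_single_succ, spacetimeCoord_single_zero]
      rw [← this]
      simp only [map_smul, smul_apply, smul_eq_mul]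
      rw [← mul_assoc, hσ, one_mul])
    (fun y h0 h1 j => by
      have h2 : Φ y = (0, (Φ y).2) := Prod.ext (by simp [Φ, spacetimeCoord_apply, h0]) rfl
      have h3 : ‖(Φ y).2‖ < R := by
        rw [← hΦ2] at h1
        exact lt_of_pow_lt_pow_left₀ 2 (hT.trans hTR).le h1
      change G (Φ y) _ = 0
      rw [h2, hinit _ h3, zero_apply])
    (y := y₀) rfl (by
      rw [← hΦ2, hΦz]
      gcongr) 0
  simp only [hΦz, Φ, spacetimeCoord_single_zero, map_smul, smul_eq_mul] at key
  have hσ0 : σ ≠ 0 := by rintro rfl; simp at hσ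
  exact (mul_eq_zero.1 key).resolve_left hσ0

theorem Set.OrdConnected.uniqueDiffOn {J : Set ℝ} (hJ : J.OrdConnected) (hJ' : J.Nontrivial) :
    UniqueDiffOn ℝ J := by
  obtain ⟨a, ha, b, hb, hab⟩ := hJ'.exists_lt
  refine uniqueDiffOn_convex hJ.convex ⟨(a + b) / 2, ?_⟩
  exact interior_maximal (Set.Ioo_subset_Icc_self.trans (hJ.out ha hb)) isOpen_Ioo
    ⟨by linarith, by linarith⟩

variable {J : Set ℝ} {u : ℝ × EuclideanSpace ℝ (Fin n) → ℝ}

theorem prod_univ_mem_nhds {z : ℝ × EuclideanSpace ℝ (Fin n)} (hz : z.1 ∈ interior J) :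
    J ×ˢ (Set.univ : Set (EuclideanSpace ℝ (Fin n))) ∈ nhds z :=
  prod_mem_nhds (mem_interior_iff_mem_nhds.1 hz) Filter.univ_mem

theorem IsWaveSolution.hasFDerivAt (hu : IsWaveSolution J u)
    {z : ℝ × EuclideanSpace ℝ (Fin n)} (hz : z.1 ∈ interior J) :
    HasFDerivAt u (fderiv ℝ u z) z :=
  ((hu.contDiffOn_one.contDiffAt (prod_univ_mem_nhds hz)).differentiableAt
    (by simp)).hasFDerivAt

theorem IsWaveSolution.eventually_mem_interior
    {z : ℝ × EuclideanSpace ℝ (Fin n)} (hz : z.1 ∈ interior J) :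
    ∀ᶠ w in nhds z, w.1 ∈ interior J :=
  continuous_fst.continuousAt.eventually_mem (isOpen_interior.mem_nhds hz)

theorem IsWaveSolution.hasFDerivAt_fderiv (hu : IsWaveSolution J u)
    {z : ℝ × EuclideanSpace ℝ (Fin n)} (hz : z.1 ∈ interior J) :
    HasFDerivAt (fderiv ℝ u) (fderiv ℝ (fderiv ℝ u) z) z :=
  (hu.differentiableAt_fderiv z.1 hz z.2).hasFDerivAt

/-- Symmetry at a point needs only differentiability of the gradient at that point, so continuity of
the second derivatives is not required. -/
theorem IsWaveSolution.fderiv_fderiv_symm (hu : IsWaveSolution J u)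
    {z : ℝ × EuclideanSpace ℝ (Fin n)} (hz : z.1 ∈ interior J)
    (v w : ℝ × EuclideanSpace ℝ (Fin n)) :
    fderiv ℝ (fderiv ℝ u) z v w = fderiv ℝ (fderiv ℝ u) z w v :=
  second_derivative_symmetric_of_eventually
    ((eventually_mem_interior hz).mono fun _ h => hu.hasFDerivAt h) (hu.hasFDerivAt_fderiv hz) v w

theorem IsWaveSolution.fderiv_fderiv_eq (hu : IsWaveSolution J u)
    {z : ℝ × EuclideanSpace ℝ (Fin n)} (hz : z.1 ∈ interior J) :
    fderiv ℝ (fderiv ℝ u) z (1, 0) (1, 0) =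
      ∑ i, fderiv ℝ (fderiv ℝ u) z (spaceDir i) (spaceDir i) := by
  obtain ⟨t, x⟩ := z
  have h2 := hu.hasFDerivAt_fderiv hz
  have ht : iteratedDeriv 2 (fun s => u (s, x)) t =
      fderiv ℝ (fderiv ℝ u) (t, x) (1, 0) (1, 0) := by
    have hline (s : ℝ) : HasDerivAt (fun s : ℝ => (s, x)) (1, 0) s :=
      (hasDerivAt_id s).prodMk (hasDerivAt_const s x)
    have h1 : deriv (fun s => u (s, x)) =ᶠ[nhds t] fun s => fderiv ℝ u (s, x) (1, 0) := by
      filter_upwards [isOpen_interior.mem_nhds hz] with s hs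
      exact ((hu.hasFDerivAt (z := (s, x)) hs).comp_hasDerivAt s (hline s)).deriv
    rw [iteratedDeriv_succ, iteratedDeriv_one, h1.deriv_eq]
    exact ((h2.apply_const (1, 0)).comp_hasDerivAt t (hline t)).deriv
  have hx : Laplacian.laplacian (fun y => u (t, y)) x =
      ∑ i, fderiv ℝ (fderiv ℝ u) (t, x) (spaceDir i) (spaceDir i) := by
    rw [InnerProductSpace.laplacian_eq_iteratedFDeriv_orthonormalBasis _
      (EuclideanSpace.basisFun (Fin n) ℝ)]
    refine Finset.sum_congr rfl fun i _ => ?_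
    have h1 : fderiv ℝ (fun y => u (t, y)) =
        fun y => (fderiv ℝ u (t, y)).comp (ContinuousLinearMap.inr ℝ ℝ _) := by
      ext1 y
      exact ((hu.hasFDerivAt (z := (t, y)) hz).comp y (hasFDerivAt_prodMk_right t y)).fderiv
    have h3 := (h2.comp x (hasFDerivAt_prodMk_right t x)).clm_comp
      (hasFDerivAt_const (ContinuousLinearMap.inr ℝ ℝ (EuclideanSpace ℝ (Fin n))) x)
    rw [iteratedFDeriv_two_apply, h1,
      show fderiv ℝ (fun y => (fderiv ℝ u (t, y)).comp (ContinuousLinearMap.inr ℝ ℝ _)) x = _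
        from h3.fderiv]
    simp [spaceDir]
  have := hu.equation t hz x
  rw [ht, hx] at this
  linarith

/-- A linear map on `ℝ × ℝⁿ` is determined by its restrictions to the two factors. The space part
comes from differentiating the initial value, so `hx` must hold near `x`; the time part is the
velocity at `x` alone. -/
theorem fderivWithin_initial_eq (hJ : J.OrdConnected) (hJ' : J.Nontrivial) (h0 : (0 : ℝ) ∈ J)
    (hu : IsWaveSolution J u) {w : ℝ × EuclideanSpace ℝ (Fin n) → ℝ} (hw : ContDiff ℝ ∞ w)
    {x : EuclideanSpace ℝ (Fin n)} (hx : ∀ᶠ y in nhds x, initialValue u y = w (0, y))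
    (hx' : initialVelocity J u x = dirDeriv (1, 0) w (0, x)) :
    fderivWithin ℝ u (J ×ˢ Set.univ) (0, x) = fderiv ℝ w (0, x) := by
  have hd : HasFDerivWithinAt u (fderivWithin ℝ u (J ×ˢ Set.univ) (0, x)) (J ×ˢ Set.univ) (0, x) :=
    (hu.contDiffOn_one.differentiableOn (by simp) (0, x) ⟨h0, trivial⟩).hasFDerivWithinAt
  have hwd : HasFDerivAt w (fderiv ℝ w (0, x)) (0, x) :=
    (hw.differentiable (by simp) (0, x)).hasFDerivAt
  have ht : fderivWithin ℝ u (J ×ˢ Set.univ) (0, x) (1, 0) = fderiv ℝ w (0, x) (1, 0) := by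
    have hline : HasDerivWithinAt (fun s : ℝ => (s, x)) (1, 0) J 0 :=
      ((hasDerivAt_id 0).prodMk (hasDerivAt_const 0 x)).hasDerivWithinAt
    have h1 := hd.comp_hasDerivWithinAt (0 : ℝ) hline fun s hs =>
      Set.mk_mem_prod hs (Set.mem_univ x)
    exact (h1.derivWithin (hJ.uniqueDiffOn hJ' 0 h0)).symm.trans hx'
  have hs : (fderivWithin ℝ u (J ×ˢ Set.univ) (0, x)).comp (ContinuousLinearMap.inr ℝ ℝ _) =
      (fderiv ℝ w (0, x)).comp (ContinuousLinearMap.inr ℝ ℝ _) := by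
    have h1 := hd.comp x (hasFDerivAt_prodMk_right (𝕜 := ℝ) (0 : ℝ) x).hasFDerivWithinAt
      (s := Set.univ) fun y _ => ⟨h0, trivial⟩
    rw [hasFDerivWithinAt_univ] at h1
    have h2 := hwd.comp x (hasFDerivAt_prodMk_right (0 : ℝ) x)
    exact h1.unique (h2.congr_of_eventuallyEq hx)
  ext
  · simpa using ht
  · rw [hs]

/-- A classical solution agrees in the cone `|t| + |x| < R` with a smooth solution whose initial
data agree for `|x| < R`. -/
theorem IsWaveSolution.eq_of_initial_eq (hJ : J.OrdConnected) (hJ' : J.Nontrivial)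
    (h0 : (0 : ℝ) ∈ J) (hu : IsWaveSolution J u) {w : ℝ × EuclideanSpace ℝ (Fin n) → ℝ}
    (hw : ContDiff ℝ ∞ w) (hww : waveOp w = 0) {R : ℝ}
    (hf : ∀ x, ‖x‖ < R → initialValue u x = w (0, x))
    (hg : ∀ x, ‖x‖ < R → initialVelocity J u x = dirDeriv (1, 0) w (0, x))
    {t : ℝ} (ht : t ∈ J) {x : EuclideanSpace ℝ (Fin n)} (hR : |t| + ‖x‖ < R) :
    u (t, x) = w (t, x) := by
  rcases eq_or_ne t 0 with rfl | ht0
  · exact hf x (by simpa using hR)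
  obtain ⟨σ, hσ, hσt⟩ : ∃ σ : ℝ, σ * σ = 1 ∧ σ * t = |t| := by
    rcases abs_cases t with h | h
    · exact ⟨1, by norm_num, by rw [h.1, one_mul]⟩
    · exact ⟨-1, by norm_num, by rw [h.1]; ring⟩
  have hT : 0 < |t| := abs_pos.2 ht0
  set S := J ×ˢ (Set.univ : Set (EuclideanSpace ℝ (Fin n)))
  have hinJ {s : ℝ} (h1 : 0 ≤ σ * s) (h2 : σ * s ≤ |t|) : s ∈ J := by
    refine hJ.uIcc_subset h0 ht ?_
    rw [← hσt] at h2
    rcases mul_self_eq_one_iff.1 hσ with rfl | rfl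
    · exact Set.mem_uIcc_of_le (by linarith) (by linarith)
    · exact Set.mem_uIcc_of_ge (by linarith) (by linarith)
  have hint {s : ℝ} (h1 : 0 < σ * s) (h2 : σ * s < |t|) : s ∈ interior J :=
    interior_maximal (t := {s | 0 < σ * s ∧ σ * s < |t|}) (fun s hs => hinJ hs.1.le hs.2.le)
      ((isOpen_Ioo (a := 0) (b := |t|)).preimage (continuous_const_mul σ))
      ⟨h1, h2⟩
  -- `fderivWithin` makes the field continuous up to `t = 0` even when `0` is an end point of `J`;
  -- at interior times it is the ordinary derivative.
  set G := fun z => fderivWithin ℝ u S z - fderiv ℝ w z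
  have hGc : ContinuousOn G S :=
    (hu.contDiffOn_one.continuousOn_fderivWithin
      ((hJ.uniqueDiffOn hJ').prod uniqueDiffOn_univ) le_rfl).sub
      (hw.continuous_fderiv (by simp)).continuousOn
  have hw2 (z) : HasFDerivAt (fderiv ℝ w) (fderiv ℝ (fderiv ℝ w) z) z :=
    ((hw.fderiv_right (m := ∞) (by simp)).differentiable (by simp) z).hasFDerivAt
  have hGd (z : ℝ × EuclideanSpace ℝ (Fin n)) (hz : z.1 ∈ interior J) :
      HasFDerivAt G (fderiv ℝ (fderiv ℝ u) z - fderiv ℝ (fderiv ℝ w) z) z := by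
    refine HasFDerivAt.sub ((hu.hasFDerivAt_fderiv hz).congr_of_eventuallyEq ?_) (hw2 z)
    filter_upwards [eventually_mem_interior hz] with y hy
    exact fderivWithin_of_mem_nhds (prod_univ_mem_nhds hy)
  -- Only times strictly between `0` and `t` are used, since `t` may be an end point of `J`. The
  -- mean value theorem along the time line then reaches `t` by continuity.
  have hzero (s : ℝ) (h1 : 0 < σ * s) (h2 : σ * s < |t|) : G (s, x) (1, 0) = 0 := by
    refine time_component_eq_zero hσ h1 (R := R)
      (H := fun z => fderiv ℝ (fderiv ℝ u) z - fderiv ℝ (fderiv ℝ w) z)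
      (hGc.mono fun z hz => ⟨hinJ hz.1 (hz.2.trans h2.le), trivial⟩)
      (fun z hz hz' => hGd z (hint hz (hz'.trans h2))) (fun z hz hz' v v' => ?_)
      (fun z hz hz' => ?_) (fun y hy => ?_) rfl (by linarith)
    · simp only [sub_apply]
      rw [hu.fderiv_fderiv_symm (hint hz (hz'.trans h2)), ← dirDeriv_dirDeriv_eq hw,
        ← dirDeriv_dirDeriv_eq hw, dirDeriv_comm hw]
    · have h3 := congrFun hww z
      simp only [waveOp, Pi.sub_apply, Finset.sum_apply, dirDeriv_dirDeriv_eq hw,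
        Pi.zero_apply, sub_eq_zero] at h3
      simp only [sub_apply, Finset.sum_sub_distrib]
      rw [h3, hu.fderiv_fderiv_eq (hint hz (hz'.trans h2))]
    · refine sub_eq_zero.2 (fderivWithin_initial_eq hJ hJ' h0 hu hw ?_ (hg y hy))
      filter_upwards [(isOpen_lt continuous_norm continuous_const).mem_nhds hy] with y' hy'
      exact hf y' hy'
  have hline (s : ℝ) : HasDerivAt (fun s : ℝ => (σ * s, x)) (σ • (1, 0)) s := by
    have := ((hasDerivAt_id s).const_mul σ).prodMk (hasDerivAt_const s x)
    simpa using this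
  have hcont : ContinuousOn (fun s => u (σ * s, x) - w (σ * s, x)) (Set.Icc 0 |t|) := by
    refine ContinuousOn.sub (hu.contDiffOn_one.continuousOn.comp (by fun_prop) fun s hs => ?_)
      (hw.continuous.comp (by fun_prop)).continuousOn
    exact ⟨hinJ (by rw [← mul_assoc, hσ]; linarith [hs.1])
      (by rw [← mul_assoc, hσ]; linarith [hs.2]), trivial⟩
  obtain ⟨c, -, hc⟩ := exists_hasDerivAt_eq_slope (fun s => u (σ * s, x) - w (σ * s, x))
    (fun _ => 0) hT hcont fun s hs => by
      have h1 : 0 < σ * (σ * s) := by rw [← mul_assoc, hσ]; linarith [hs.1]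
      have h2 : σ * (σ * s) < |t| := by rw [← mul_assoc, hσ]; linarith [hs.2]
      have h3 := ((hu.hasFDerivAt (z := (σ * s, x)) (hint h1 h2)).comp_hasDerivAt s (hline s)).sub
        ((hw.differentiable (by simp) (σ * s, x)).hasFDerivAt.comp_hasDerivAt s (hline s))
      have h4 := hzero _ h1 h2
      simp only [G, S, fderivWithin_of_mem_nhds (prod_univ_mem_nhds
        (z := (σ * s, x)) (hint h1 h2)), sub_apply] at h4
      simp only [map_smul, ← smul_sub, h4, smul_zero] at h3
      exact h3
  have hst : σ * |t| = t := by rw [← hσt, ← mul_assoc, hσ, one_mul]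
  simp only [hst, mul_zero, sub_zero] at hc
  have h5 : u (0, x) = w (0, x) := hf x (by linarith)
  rw [h5, sub_self, sub_zero, eq_comm, div_eq_zero_iff] at hc
  exact sub_eq_zero.1 (hc.resolve_right hT.ne')

end Uniqueness

theorem mainTheorem9 (n : ℕ) (J : Set ℝ) (hJ : J.OrdConnected) (hJ' : J.Nontrivial)
    (h0 : (0 : ℝ) ∈ J) (u : ℝ × EuclideanSpace ℝ (Fin n) → ℝ) (hu : IsWaveSolution J u)
    (hu0 : ContDiff ℝ ∞ (initialValue u)) (hu1 : ContDiff ℝ ∞ (initialVelocity J u)) :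
    ContDiffOn ℝ ∞ u (J ×ˢ Set.univ) := by
  rintro ⟨t, x⟩ ⟨ht, -⟩
  -- The extra `1` leaves room for a whole neighbourhood of `(t, x)` inside the cone of radius `R`.
  set R := |t| + ‖x‖ + 1
  have hRpos : 0 < R := by positivity
  let χ : ContDiffBump (0 : EuclideanSpace ℝ (Fin n)) := ⟨R, R + 1, hRpos, by linarith⟩
  have hχ {y : EuclideanSpace ℝ (Fin n)} (hy : ‖y‖ < R) : χ y = 1 :=
    χ.one_of_mem_closedBall (by simpa using hy.le)
  -- The truncated data agree with the original data on the ball of radius `R`, where `χ = 1`.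
  obtain ⟨w, hw, hww, hwf, hwg⟩ := exists_wave (χ.contDiff.mul hu0) χ.hasCompactSupport.mul_right
    (χ.contDiff.mul hu1) χ.hasCompactSupport.mul_right
  have heq {z : ℝ × EuclideanSpace ℝ (Fin n)} (hz : z.1 ∈ J) (hzR : |z.1| + ‖z.2‖ < R) :
      u z = w z :=
    hu.eq_of_initial_eq hJ hJ' h0 hw hww (R := R) (fun y hy => by simp [hwf, hχ hy])
      (fun y hy => by simp [hwg, hχ hy]) hz hzR
  refine hw.contDiffAt.contDiffWithinAt.congr_of_eventuallyEq ?_ (heq ht (by simp [R]))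
  have hopen : IsOpen {z : ℝ × EuclideanSpace ℝ (Fin n) | |z.1| + ‖z.2‖ < R} :=
    isOpen_lt (by fun_prop) continuous_const
  filter_upwards [self_mem_nhdsWithin, mem_nhdsWithin_of_mem_nhds
    (hopen.mem_nhds (x := (t, x)) (by simp [R]))] with z hz hz'
  exact heq hz.1 hz'
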